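/- There is a universal constant $C>0$ such that the following holds for all integers $r\ge 2$ and $n\ge 0$ and all probability distributions $D_1,\dots,D_n$ on $[0,\infty)$. There is a (possibly randomized) online algorithm, depending only on $r,n,D_1,\dots,D_n$, which observes real numbers $X_1,\dots,X_n$ one at a time, irrevocably accepts or rejects each $X_i$ on arrival (using only $X_1,\dots,X_i$ and its internal randomness), accepts at most $r$ of them, and has the following guarantee. Let $Z_1,\dots,Z_n$ be independent random variables with $Z_i\sim D_i$, let $W_1,\dots,W_n\ge 0$ be random variables on the same probability space, put $X_i=Z_i+W_i$, and suppose that for every $i$ the variable $Z_i$ is independent of $(X_1,\dots,X_{i-1})$. (Otherwise the $W_i$ are arbitrary and unknown to the algorithm; its internal randomness is independent of all $Z_i,W_i$.) If $Q\subseteq\{1,\dots,n\}$ is the random set of accepted indices, then $$\mathbb E\Big[\sum_{i\in Q}X_i\Big]\;\ge\;\frac{1}{1+C\,\frac{(\log r)^{3/2}}{r^{1/4}}}\;\mathbb E\Big[\sum_{k=1}^{r}Z^{(k)}\Big],$$ where $Z^{(k)}$ is the $k$-th largest of $Z_1,\dots,Z_n$ (and $Z^{(k)}=0$ for $k>n$).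 Expectations take values in $[0,\infty]$. -/

import Mathlib

open MeasureTheory ProbabilityTheory

universe u

noncomputable section

/-- The `k`-th largest entry of `z`, counted from `k = 0` and with multiplicity; it is `0` when `z`
has at most `k` entries. -/
def kthLargest {n : ℕ} (z : Fin n → ℝ) (k : ℕ) : ℝ :=
  ((Finset.univ.val.map z).sort (· ≥ ·)).getD k 0

/-- The sum of the `r` largest entries of `z`. -/
def topSum {n : ℕ} (r : ℕ) (z : Fin n → ℝ) : ℝ :=
  ∑ k ∈ Finset.range r, kthLargest z k

/-- A randomized online algorithm that sees `n` real numbers one at a time and irrevocably accepts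
or rejects each of them on arrival, accepting at most `r` in total. The random seed is drawn once,
before the first arrival. -/
structure OnlineAlgorithm (n r : ℕ) where
  /-- The space of random seeds. -/
  Seed : Type
  [measurableSpaceSeed : MeasurableSpace Seed]
  /-- The distribution of the seed. -/
  seedLaw : Measure Seed
  [isProbabilityMeasure_seedLaw : IsProbabilityMeasure seedLaw]
  /-- The set of accepted indices, for a given seed and given values. -/
  accept : Seed → (Fin n → ℝ) → Finset (Fin n)
  measurableSet_accept :
    ∀ i, MeasurableSet {p : Seed × (Fin n → ℝ) | i ∈ accept p.1 p.2}
  /-- The decision on the `i`-th arrival uses only the seed and the values that arrived up to `i`. -/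
  online : ∀ s x y i, (∀ j ≤ i, x j = y j) → (i ∈ accept s x ↔ i ∈ accept s y)
  card_accept_le : ∀ s x, (accept s x).card ≤ r

attribute [instance] OnlineAlgorithm.measurableSpaceSeed
  OnlineAlgorithm.isProbabilityMeasure_seedLaw

/-- The expected total value accepted by the algorithm when the arriving values are `X 0, X 1, …`;
its seed is independent of everything else. -/
def OnlineAlgorithm.expectedReward {n r : ℕ} (A : OnlineAlgorithm n r) {Ω : Type*}
    [MeasurableSpace Ω] (P : Measure Ω) (X : Fin n → Ω → ℝ) : ENNReal :=
  ∫⁻ p, ENNReal.ofReal (∑ i ∈ A.accept p.2 (fun k => X k p.1), X i p.1) ∂(P.prod A.seedLaw)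

/-- `Z` and `W` form an instance of the augmented prophets problem with marginals `D`: the `Z i` are
independent with laws `D i`, the bonuses `W i` are nonnegative, and each `Z i` is independent of the
tuple of all earlier augmented values `Z j + W j`, `j < i`. -/
structure IsAugmentedInstance {n : ℕ} (D : Fin n → Measure ℝ) {Ω : Type*} [MeasurableSpace Ω]
    (P : Measure Ω) (Z W : Fin n → Ω → ℝ) : Prop where
  measurable_Z : ∀ i, Measurable (Z i)
  measurable_W : ∀ i, Measurable (W i)
  law_Z : ∀ i, P.map (Z i) = D i
  iIndepFun_Z : iIndepFun Z P
  nonneg_W : ∀ i, ∀ᵐ ω ∂P, 0 ≤ W i ω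
  indepFun_past : ∀ i,
    IndepFun (Z i) (fun ω (j : {j : Fin n // j < i}) => Z j ω + W j ω) P

/-- On every augmented instance with marginals `D`, the algorithm `A` obtains at least a `1 / α`
fraction of the expected sum of the `r` largest `Z i`. The algorithm may depend on `D` but not on
the bonuses. -/
def OnlineAlgorithm.HasApproximationRatio {n r : ℕ} (A : OnlineAlgorithm n r)
    (D : Fin n → Measure ℝ) (α : ℝ) : Prop :=
  ∀ (Ω : Type u) [MeasurableSpace Ω] (P : Measure Ω) [IsProbabilityMeasure P]
    (Z W : Fin n → Ω → ℝ), IsAugmentedInstance D P Z W →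
      (∫⁻ ω, ENNReal.ofReal (topSum r (fun i => Z i ω)) ∂P) / ENNReal.ofReal α ≤
        A.expectedReward P (fun i ω => Z i ω + W i ω)

end

/-!
A strategy that maximizes "value at hand plus potential of the remaining slots" is immune to the
bonuses: the number of slots left is a function of the past, hence independent of the next `Z i`,
and adding a bonus can only raise the maximum. So it collects at least the initial potential as soon
as the potential never exceeds the expected maximum of one step.

Such a potential comes from the ex-ante relaxation. The optimal choice of `r` values accepts the
`i`-th one according to a measure `ν i ≤ D i`, the total mass being at most `r`. Attempting
independently only a fraction `1 - δ` of each `ν i` uses up the `r` slots with probability at most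
`exp (-r δ² / 2)`, by a Chernoff bound which, truncated at time `i`, satisfies the recursion of the
potential. With `δ = √(log r / r)` both losses are `O(√(log r / r))`.
-/

open scoped ENNReal

theorem sum_range_getD {M : Type*} [AddCommMonoid M] (l : List M) (r : ℕ) :
    ∑ k ∈ Finset.range r, l.getD k 0 = (l.take r).sum := by
  induction l generalizing r with
  | nil => simp
  | cons a l ih =>
    cases r with
    | zero => simp
    | succ r => simpa [Finset.sum_range_succ', add_comm] using congrArg (a + ·) (ih r)

theorem exists_card_le_topSum_eq_sum {n : ℕ} (r : ℕ) (z : Fin n → ℝ) :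
    ∃ S : Finset (Fin n), S.card ≤ r ∧ topSum r z = ∑ i ∈ S, z i := by
  have hperm : ((Finset.univ.val.map z).sort (· ≥ ·)).Perm ((List.finRange n).map z) := by
    rw [← Multiset.coe_eq_coe, Multiset.sort_eq]
    rfl
  obtain ⟨L, hsort, hL⟩ : Relation.Comp (· = List.map z ·) List.Perm
      ((Finset.univ.val.map z).sort (· ≥ ·)) (List.finRange n) := by
    rwa [List.eq_map_comp_perm]
  have hnodup : (L.take r).Nodup := (hL.nodup_iff.2 (List.nodup_finRange n)).take
  refine ⟨(L.take r).toFinset, ?_, ?_⟩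
  · rw [List.toFinset_card_of_nodup hnodup]
    exact List.length_take_le r L
  · rw [List.sum_toFinset z hnodup, List.map_take, ← hsort]
    exact sum_range_getD _ r

theorem exists_measurable_argmax {ι α β : Type*} [Finite ι] [Nonempty ι] [MeasurableSpace ι]
    [DiscreteMeasurableSpace ι] [MeasurableSpace α] [LinearOrder β] [TopologicalSpace β]
    [OrderClosedTopology β] [SecondCountableTopology β] [MeasurableSpace β] [OpensMeasurableSpace β]
    {f : ι → α → β} (hf : ∀ i, Measurable (f i)) :
    ∃ g : α → ι, Measurable g ∧ ∀ x i, f i x ≤ f (g x) x := by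
  classical
  have := Fintype.ofFinite ι
  suffices h : ∀ s : Finset ι, ∃ g : α → ι, Measurable g ∧ ∀ x, ∀ i ∈ s, f i x ≤ f (g x) x by
    simpa using h Finset.univ
  intro s
  induction s using Finset.induction with
  | empty => exact ⟨fun _ => Classical.arbitrary ι, measurable_const, by simp⟩
  | insert j s _ ih =>
    obtain ⟨g, hg, hmax⟩ := ih
    have hfg : Measurable fun x => f (g x) x :=
      (measurable_from_prod_countable_right (f := fun p : ι × α => f p.1 p.2) hf).comp
        (hg.prodMk measurable_id)
    refine ⟨fun x => if f (g x) x ≤ f j x then j else g x,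
      Measurable.ite (measurableSet_le hfg (hf j)) measurable_const hg, fun x i hi => ?_⟩
    rcases Finset.mem_insert.1 hi with rfl | hi <;> dsimp only <;> split_ifs with h
    · exact le_rfl
    · exact (not_le.1 h).le
    · exact (hmax x i hi).trans h
    · exact hmax x i hi

theorem exists_measurable_selection_topSum_le (n r : ℕ) :
    ∃ S : (Fin n → ℝ) → Finset (Fin n), (∀ i, MeasurableSet {x | i ∈ S x}) ∧
      (∀ x, (S x).card ≤ r) ∧ ∀ x, topSum r x ≤ ∑ i ∈ S x, x i := by
  let ι := {T : Finset (Fin n) // T.card ≤ r}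
  let _ : MeasurableSpace ι := ⊤
  have : Nonempty ι := ⟨⟨∅, by simp⟩⟩
  obtain ⟨S, hS, hmax⟩ := exists_measurable_argmax
    (f := fun (T : ι) (x : Fin n → ℝ) => ∑ i ∈ T.1, x i) fun T => by fun_prop
  refine ⟨fun x => (S x).1, fun i => hS (MeasurableSet.of_discrete (s := {T : ι | i ∈ T.1})),
    fun x => (S x).2, fun x => ?_⟩
  obtain ⟨T, hT, hsum⟩ := exists_card_le_topSum_eq_sum r x
  exact hsum.trans_le (hmax x ⟨T, hT⟩)

section RandomFinset

variable {α ι : Type*} {S : α → Finset ι} {f : ι → α → ℝ≥0∞}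

theorem sum_mem_eq_sum_indicator [Fintype ι] (x : α) :
    ∑ i ∈ S x, f i x = ∑ i, {x | i ∈ S x}.indicator (f i) x := by
  classical
  simp [Set.indicator_apply, Finset.sum_ite_mem]

theorem measurable_sum_mem [Finite ι] [MeasurableSpace α]
    (hS : ∀ i, MeasurableSet {x | i ∈ S x}) (hf : ∀ i, Measurable (f i)) :
    Measurable fun x => ∑ i ∈ S x, f i x := by
  have := Fintype.ofFinite ι
  simp_rw [sum_mem_eq_sum_indicator]
  exact Finset.measurable_fun_sum _ fun i _ => (hf i).indicator (hS i)

theorem lintegral_sum_mem [Fintype ι] [MeasurableSpace α]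
    (hS : ∀ i, MeasurableSet {x | i ∈ S x}) (hf : ∀ i, Measurable (f i)) (μ : Measure α) :
    ∫⁻ x, ∑ i ∈ S x, f i x ∂μ = ∑ i, ∫⁻ x in {x | i ∈ S x}, f i x ∂μ := by
  simp_rw [sum_mem_eq_sum_indicator, ← lintegral_indicator (hS _)]
  exact lintegral_finsetSum _ fun i _ => (hf i).indicator (hS i)

end RandomFinset

/-- The measure `ν i` is the law of `x i` under the product measure, restricted to the event that a
measurably chosen optimal set of at most `r` indices contains `i`. -/
theorem exists_exAnte_relaxation {n : ℕ} (D : Fin n → Measure ℝ) [∀ i, IsProbabilityMeasure (D i)]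
    (r : ℕ) :
    ∃ ν : Fin n → Measure ℝ, (∀ i, ν i ≤ D i) ∧ ∑ i, ν i Set.univ ≤ r ∧
      ∀ {Ω : Type u} [MeasurableSpace Ω] {P : Measure Ω} {X : Ω → Fin n → ℝ},
        MeasurePreserving X P (Measure.pi D) →
          ∫⁻ ω, ENNReal.ofReal (topSum r (X ω)) ∂P ≤ ∑ i, ∫⁻ z, ENNReal.ofReal z ∂(ν i) := by
  obtain ⟨S, hS, hcard, htop⟩ := exists_measurable_selection_topSum_le n r
  refine ⟨fun i => ((Measure.pi D).restrict {x | i ∈ S x}).map (Function.eval i),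
    fun i => ?_, ?_, fun {Ω} _ {P} {X} hX => ?_⟩
  · rw [← (measurePreserving_eval D i).map_eq]
    exact Measure.map_mono Measure.restrict_le_self (measurable_pi_apply i)
  · calc ∑ i, ((Measure.pi D).restrict {x | i ∈ S x}).map (Function.eval i) Set.univ
        = ∑ i, ∫⁻ _ in {x | i ∈ S x}, 1 ∂(Measure.pi D) := by
          simp [Measure.map_apply (measurable_pi_apply _)]
      _ = ∫⁻ x, ∑ _i ∈ S x, 1 ∂(Measure.pi D) :=
          (lintegral_sum_mem hS (fun _ => measurable_const) _).symm
      _ ≤ ∫⁻ _, r ∂(Measure.pi D) := lintegral_mono fun x => by simpa using hcard x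
      _ = r := by simp
  · calc ∫⁻ ω, ENNReal.ofReal (topSum r (X ω)) ∂P
        ≤ ∫⁻ ω, ∑ i ∈ S (X ω), ENNReal.ofReal (X ω i) ∂P :=
          lintegral_mono fun ω => (ENNReal.ofReal_le_ofReal (htop (X ω))).trans
            (Finset.le_sum_of_subadditive _ ENNReal.ofReal_zero.le
              (fun _ _ => ENNReal.ofReal_add_le) _ _)
      _ = ∫⁻ x, ∑ i ∈ S x, ENNReal.ofReal (x i) ∂(Measure.pi D) :=
          hX.lintegral_comp (measurable_sum_mem hS fun i => (measurable_pi_apply i).ennreal_ofReal)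
      _ = ∑ i, ∫⁻ x in {x | i ∈ S x}, ENNReal.ofReal (x i) ∂(Measure.pi D) :=
          lintegral_sum_mem hS (fun i => (measurable_pi_apply i).ennreal_ofReal) _
      _ = ∑ i, ∫⁻ z, ENNReal.ofReal z
            ∂(((Measure.pi D).restrict {x | i ∈ S x}).map (Function.eval i)) := by
          refine Finset.sum_congr rfl fun i _ => ?_
          rw [lintegral_map ENNReal.measurable_ofReal (measurable_pi_apply i)]

/-- The sequence of arrivals `x`, continued by zeros so that an online algorithm can be run on it by
recursion over `ℕ`. -/
noncomputable def arrivals {n : ℕ} (x : Fin n → ℝ) : ℕ → ℝ :=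
  Function.extend Fin.val x 0

@[simp]
theorem arrivals_val {n : ℕ} (x : Fin n → ℝ) (i : Fin n) : arrivals x i = x i :=
  Fin.val_injective.extend_apply x 0 i

theorem measurable_extend_zero {ι κ M : Type*} [Zero M] [MeasurableSpace M] (f : ι → κ) :
    Measurable fun x : ι → M => Function.extend f x 0 := by
  refine measurable_pi_lambda _ fun k => ?_
  by_cases hk : ∃ i, f i = k
  · have hextend : (fun x : ι → M => Function.extend f x 0 k) = fun x => x hk.choose :=
      funext fun _ => dif_pos hk
    rw [hextend]
    exact measurable_pi_apply _
  · simpa only [Function.extend_apply' _ _ _ hk] using measurable_const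

theorem measurable_arrivals {n : ℕ} : Measurable (arrivals : (Fin n → ℝ) → ℕ → ℝ) :=
  measurable_extend_zero _

/-- The best value of the `i`-th decision under the potential `Φ`, where `m` is the number of slots
left and `z` the value at hand: the reward of the decision plus the potential after it. It is `0`
when no slot is left. -/
def decisionValue (Φ : ℕ → ℕ → ℝ≥0∞) (i : ℕ) : ℕ → ℝ → ℝ≥0∞
  | 0, _ => 0
  | m + 1, z => max (ENNReal.ofReal z + Φ (i + 1) m) (Φ (i + 1) (m + 1))

/-- The greedy decision under the potential `Φ` on an `i`-th value `z` with `m` slots left. The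
inequality is strict so that, for a potential monotone in `m`, only positive values qualify. -/
def ShouldAccept (Φ : ℕ → ℕ → ℝ≥0∞) (i : ℕ) : ℕ → ℝ → Prop
  | 0, _ => False
  | m + 1, z => Φ (i + 1) (m + 1) < ENNReal.ofReal z + Φ (i + 1) m

open scoped Classical in
/-- The number of slots left before the `i`-th arrival when the greedy decisions under `Φ` are
followed from `r` slots on. -/
noncomputable def slotsLeft (Φ : ℕ → ℕ → ℝ≥0∞) (r : ℕ) (x : ℕ → ℝ) : ℕ → ℕ
  | 0 => r
  | i + 1 =>
    if ShouldAccept Φ i (slotsLeft Φ r x i) (x i) then slotsLeft Φ r x i - 1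
    else slotsLeft Φ r x i

/-- The `i`-th value of `x` is accepted by the greedy rule under `Φ` started with `r` slots. -/
def GreedyAccepts (Φ : ℕ → ℕ → ℝ≥0∞) (r : ℕ) (x : ℕ → ℝ) (i : ℕ) : Prop :=
  ShouldAccept Φ i (slotsLeft Φ r x i) (x i)

open scoped Classical in
/-- The reward that the greedy rule under `Φ` collects from the `i`-th value of `x`. -/
noncomputable def greedyReward (Φ : ℕ → ℕ → ℝ≥0∞) (r : ℕ) (x : ℕ → ℝ) (i : ℕ) : ℝ≥0∞ :=
  if GreedyAccepts Φ r x i then ENNReal.ofReal (x i) else 0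

section Greedy

variable {Φ : ℕ → ℕ → ℝ≥0∞} {r i : ℕ}

theorem measurable_decisionValue :
    Measurable fun p : ℕ × ℝ => decisionValue Φ i p.1 p.2 := by
  refine measurable_from_prod_countable_right fun m => ?_
  cases m <;> simp only [decisionValue] <;> fun_prop

theorem measurableSet_shouldAccept : MeasurableSet {p : ℕ × ℝ | ShouldAccept Φ i p.1 p.2} := by
  refine measurableSet_setOfPred.2 (measurable_from_prod_countable_right fun m => ?_)
  cases m with
  | zero => exact measurable_const
  | succ m =>
    exact measurableSet_setOfPred.1
      (measurableSet_lt measurable_const (ENNReal.measurable_ofReal.add_const _))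

theorem pos_of_shouldAccept (hΦ : Monotone (Φ (i + 1))) :
    ∀ {m : ℕ} {z : ℝ}, ShouldAccept Φ i m z → 0 < z
  | m + 1, z, h => by
    by_contra! hz
    rw [ShouldAccept, ENNReal.ofReal_of_nonpos hz, zero_add] at h
    exact h.not_ge (hΦ m.le_succ)

theorem slotsLeft_congr {x y : ℕ → ℝ} (h : ∀ j < i, x j = y j) :
    slotsLeft Φ r x i = slotsLeft Φ r y i := by
  induction i with
  | zero => rfl
  | succ i ih =>
    rw [slotsLeft, slotsLeft, ih fun j hj => h j (hj.trans i.lt_succ_self), h i i.lt_succ_self]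

theorem greedyAccepts_congr {x y : ℕ → ℝ} (h : ∀ j ≤ i, x j = y j) :
    GreedyAccepts Φ r x i ↔ GreedyAccepts Φ r y i := by
  rw [GreedyAccepts, GreedyAccepts, slotsLeft_congr fun j hj => h j hj.le, h i le_rfl]

theorem measurable_slotsLeft : Measurable fun x => slotsLeft Φ r x i := by
  induction i with
  | zero => exact measurable_const
  | succ i ih =>
    exact Measurable.ite ((ih.prodMk (measurable_pi_apply i)) measurableSet_shouldAccept)
      ((measurable_of_countable fun m : ℕ => m - 1).comp ih) ih

theorem measurableSet_greedyAccepts : MeasurableSet {x | GreedyAccepts Φ r x i} :=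
  (measurable_slotsLeft.prodMk (measurable_pi_apply i)) measurableSet_shouldAccept

theorem measurable_greedyReward : Measurable fun x => greedyReward Φ r x i :=
  Measurable.ite measurableSet_greedyAccepts (measurable_pi_apply i).ennreal_ofReal
    measurable_const

theorem slotsLeft_succ_of_greedyAccepts {x : ℕ → ℝ} (h : GreedyAccepts Φ r x i) :
    slotsLeft Φ r x (i + 1) = slotsLeft Φ r x i - 1 :=
  if_pos h

theorem slotsLeft_succ_of_not_greedyAccepts {x : ℕ → ℝ} (h : ¬ GreedyAccepts Φ r x i) :
    slotsLeft Φ r x (i + 1) = slotsLeft Φ r x i :=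
  if_neg h

open scoped Classical in
theorem card_filter_greedyAccepts_add_slotsLeft (x : ℕ → ℝ) (k : ℕ) :
    ((Finset.range k).filter (GreedyAccepts Φ r x)).card + slotsLeft Φ r x k = r := by
  induction k with
  | zero => simp [slotsLeft]
  | succ k ih =>
    rw [Finset.range_add_one, Finset.filter_insert]
    by_cases h : GreedyAccepts Φ r x k
    · have hslots : slotsLeft Φ r x k ≠ 0 := fun h0 => by
        rwa [GreedyAccepts, h0] at h
      rw [if_pos h, slotsLeft_succ_of_greedyAccepts h, Finset.card_insert_of_notMem (by simp)]
      omega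
    · rwa [if_neg h, slotsLeft_succ_of_not_greedyAccepts h]

theorem decisionValue_le_greedyReward_add {x : ℕ → ℝ} {z : ℝ} (hz : z ≤ x i) :
    decisionValue Φ i (slotsLeft Φ r x i) z ≤
      greedyReward Φ r x i + Φ (i + 1) (slotsLeft Φ r x (i + 1)) := by
  have hle := ENNReal.ofReal_le_ofReal hz
  rw [greedyReward, GreedyAccepts, slotsLeft]
  rcases slotsLeft Φ r x i with _ | m
  · exact zero_le
  · by_cases h : ShouldAccept Φ i (m + 1) (x i)
    · rw [if_pos h, if_pos h]
      exact max_le (by gcongr; rfl) (le_of_lt h)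
    · rw [if_neg h, if_neg h, zero_add]
      refine max_le ?_ le_rfl
      calc ENNReal.ofReal z + Φ (i + 1) m ≤ ENNReal.ofReal (x i) + Φ (i + 1) m := by gcongr
        _ ≤ Φ (i + 1) (m + 1) := not_lt.1 h

end Greedy

open scoped Classical in
/-- The online algorithm that follows the greedy decisions under `Φ`. It is deterministic: its seed
is the unique element of `Unit`. -/
noncomputable def greedyAlgorithm (n r : ℕ) (Φ : ℕ → ℕ → ℝ≥0∞) : OnlineAlgorithm n r where
  Seed := Unit
  seedLaw := Measure.dirac ()
  accept _ x := {i | GreedyAccepts Φ r (arrivals x) i}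
  measurableSet_accept i := by
    simp only [Finset.mem_filter, Finset.mem_univ, true_and]
    exact (measurable_arrivals.comp measurable_snd) measurableSet_greedyAccepts
  online _ x y i h := by
    simp only [Finset.mem_filter, Finset.mem_univ, true_and]
    refine greedyAccepts_congr fun j hj => ?_
    simpa only [← arrivals_val] using h ⟨j, hj.trans_lt i.2⟩ hj
  card_accept_le _ x := by
    rw [← Finset.card_map Fin.valEmbedding]
    refine (Finset.card_le_card fun j hj => ?_).trans
      ((Nat.le_add_right _ _).trans_eq
        (card_filter_greedyAccepts_add_slotsLeft (Φ := Φ) (arrivals x) n))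
    obtain ⟨i, hi, rfl⟩ := Finset.mem_map.1 hj
    simpa using hi

theorem expectedReward_greedyAlgorithm {n r : ℕ} {Φ : ℕ → ℕ → ℝ≥0∞} (hΦ : ∀ i, Monotone (Φ i))
    {Ω : Type*} [MeasurableSpace Ω] (P : Measure Ω) {X : Fin n → Ω → ℝ}
    (hX : ∀ i, Measurable (X i)) :
    (greedyAlgorithm n r Φ).expectedReward P X =
      ∑ i ∈ Finset.range n, ∫⁻ ω, greedyReward Φ r (arrivals fun k => X k ω) i ∂P := by
  have hx : Measurable fun ω => arrivals fun k => X k ω :=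
    measurable_arrivals.comp (measurable_pi_lambda _ hX)
  have hreward : ∀ x : Fin n → ℝ, ∀ s,
      ENNReal.ofReal (∑ i ∈ (greedyAlgorithm n r Φ).accept s x, x i) =
        ∑ i ∈ Finset.range n, greedyReward Φ r (arrivals x) i := by
    intro x s
    rw [ENNReal.ofReal_sum_of_nonneg, Finset.sum_range]
    · simp only [greedyAlgorithm, Finset.sum_filter, greedyReward, arrivals_val]
    · intro i hi
      have haccept : GreedyAccepts Φ r (arrivals x) i := by
        simpa [greedyAlgorithm] using hi
      rw [← arrivals_val x i]
      exact (pos_of_shouldAccept (hΦ _) haccept).le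
  have hmeas : ∀ i, Measurable fun ω => greedyReward Φ r (arrivals fun k => X k ω) i :=
    fun i => measurable_greedyReward.comp hx
  rw [OnlineAlgorithm.expectedReward, ← lintegral_finsetSum _ fun i _ => hmeas i]
  simp_rw [hreward]
  exact measurePreserving_fst.lintegral_comp (Finset.measurable_fun_sum _ fun i _ => hmeas i)

/-- A potential that a single decision cannot be expected to lower: before the `i`-th arrival with
`m` slots left it is at most the expected value of the best decision. -/
structure IsSubPotential {n : ℕ} (D : Fin n → Measure ℝ) (Φ : ℕ → ℕ → ℝ≥0∞) : Prop where
  monotone : ∀ i, Monotone (Φ i)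
  last : ∀ m, Φ n m = 0
  le_lintegral : ∀ (i : Fin n) m, Φ i m ≤ ∫⁻ z, decisionValue Φ i m z ∂(D i)

theorem lintegral_lintegral_of_indepFun {Ω α β : Type*} [MeasurableSpace Ω] [MeasurableSpace α]
    [MeasurableSpace β] {P : Measure Ω} [IsFiniteMeasure P] {X : Ω → α} {Y : Ω → β}
    (hX : Measurable X) (hY : Measurable Y) (h : IndepFun X Y P) {f : α × β → ℝ≥0∞}
    (hf : Measurable f) :
    ∫⁻ ω, ∫⁻ y, f (X ω, y) ∂(P.map Y) ∂P = ∫⁻ ω, f (X ω, Y ω) ∂P := by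
  calc ∫⁻ ω, ∫⁻ y, f (X ω, y) ∂(P.map Y) ∂P
      = ∫⁻ x, ∫⁻ y, f (x, y) ∂(P.map Y) ∂(P.map X) :=
        (lintegral_map hf.lintegral_prod_right' hX).symm
    _ = ∫⁻ p, f p ∂((P.map X).prod (P.map Y)) := (lintegral_prod _ hf.aemeasurable).symm
    _ = ∫⁻ ω, f (X ω, Y ω) ∂P := by
        rw [← (indepFun_iff_map_prod_eq_prod_map_map hX.aemeasurable hY.aemeasurable).1 h,
          lintegral_map hf (hX.prodMk hY)]

section AugmentedInstance

variable {n : ℕ} {D : Fin n → Measure ℝ} {Φ : ℕ → ℕ → ℝ≥0∞} {Ω : Type*} [MeasurableSpace Ω]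
  {P : Measure Ω} {Z W : Fin n → Ω → ℝ} {r : ℕ}

theorem IsAugmentedInstance.measurable_arrivals (h : IsAugmentedInstance D P Z W) :
    Measurable fun ω => arrivals fun k => Z k ω + W k ω :=
  _root_.measurable_arrivals.comp
    (measurable_pi_lambda _ fun k => (h.measurable_Z k).add (h.measurable_W k))

theorem IsAugmentedInstance.indepFun_slotsLeft (h : IsAugmentedInstance D P Z W) (i : Fin n) :
    IndepFun (fun ω => slotsLeft Φ r (arrivals fun k => Z k ω + W k ω) i) (Z i) P := by
  let past (ω : Ω) (j : {j : Fin n // j < i}) : ℝ := Z j ω + W j ω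
  let index (j : {j : Fin n // j < i}) : ℕ := j.1
  have hindex : Function.Injective index := Fin.val_injective.comp Subtype.val_injective
  have hslots : (fun ω => slotsLeft Φ r (arrivals fun k => Z k ω + W k ω) i) =
      (fun y => slotsLeft Φ r (Function.extend index y 0) i) ∘ past := by
    funext ω
    refine slotsLeft_congr fun j hj => ?_
    let k : {j : Fin n // j < i} := ⟨⟨j, hj.trans i.2⟩, hj⟩
    exact (arrivals_val _ k.1).trans (hindex.extend_apply (past ω) 0 k).symm
  rw [hslots]
  exact ((h.indepFun_past i).comp measurable_id
    (measurable_slotsLeft.comp (measurable_extend_zero index))).symm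

theorem IsSubPotential.lintegral_le_lintegral_succ [IsFiniteMeasure P]
    (hΦ : IsSubPotential D Φ) (h : IsAugmentedInstance D P Z W) (i : Fin n) :
    ∫⁻ ω, Φ i (slotsLeft Φ r (arrivals fun k => Z k ω + W k ω) i) ∂P ≤
      ∫⁻ ω, greedyReward Φ r (arrivals fun k => Z k ω + W k ω) i ∂P +
        ∫⁻ ω, Φ (i + 1) (slotsLeft Φ r (arrivals fun k => Z k ω + W k ω) (i + 1)) ∂P := by
  set X : Ω → ℕ → ℝ := fun ω => arrivals fun k => Z k ω + W k ω
  have hX : Measurable X := h.measurable_arrivals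
  have hXi : ∀ ω, X ω i = Z i ω + W i ω := fun ω => arrivals_val _ i
  calc ∫⁻ ω, Φ i (slotsLeft Φ r (X ω) i) ∂P
      ≤ ∫⁻ ω, ∫⁻ z, decisionValue Φ i (slotsLeft Φ r (X ω) i) z ∂(P.map (Z i)) ∂P := by
        rw [h.law_Z i]
        exact lintegral_mono fun ω => hΦ.le_lintegral i _
    _ = ∫⁻ ω, decisionValue Φ i (slotsLeft Φ r (X ω) i) (Z i ω) ∂P :=
        lintegral_lintegral_of_indepFun (measurable_slotsLeft.comp hX) (h.measurable_Z i)
          (h.indepFun_slotsLeft i) measurable_decisionValue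
    _ ≤ ∫⁻ ω, (greedyReward Φ r (X ω) i + Φ (i + 1) (slotsLeft Φ r (X ω) (i + 1))) ∂P := by
        refine lintegral_mono_ae ?_
        filter_upwards [h.nonneg_W i] with ω hW
        exact decisionValue_le_greedyReward_add
          ((le_add_of_nonneg_right hW).trans_eq (hXi ω).symm)
    _ = _ := lintegral_add_left (measurable_greedyReward.comp hX) _

theorem IsSubPotential.le_sum_add_lintegral [IsProbabilityMeasure P] (hΦ : IsSubPotential D Φ)
    (h : IsAugmentedInstance D P Z W) {k : ℕ} (hk : k ≤ n) :
    Φ 0 r ≤ ∑ i ∈ Finset.range k,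
        ∫⁻ ω, greedyReward Φ r (arrivals fun k => Z k ω + W k ω) i ∂P +
      ∫⁻ ω, Φ k (slotsLeft Φ r (arrivals fun k => Z k ω + W k ω) k) ∂P := by
  induction k with
  | zero => simp [slotsLeft]
  | succ k ih =>
    rw [Finset.sum_range_succ, add_assoc]
    exact (ih (by omega)).trans
      (add_le_add_right (hΦ.lintegral_le_lintegral_succ h ⟨k, hk⟩) _)

/-- The bonuses can only help: they raise the value of accepting, and the past they reveal is
independent of the next `Z i`. -/
theorem IsSubPotential.le_expectedReward [IsProbabilityMeasure P] (hΦ : IsSubPotential D Φ)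
    (h : IsAugmentedInstance D P Z W) :
    Φ 0 r ≤ (greedyAlgorithm n r Φ).expectedReward P (fun i ω => Z i ω + W i ω) := by
  rw [expectedReward_greedyAlgorithm (X := fun i ω => Z i ω + W i ω) hΦ.monotone P
    fun i => (h.measurable_Z i).add (h.measurable_W i)]
  simpa only [hΦ.last, lintegral_zero, add_zero] using hΦ.le_sum_add_lintegral h le_rfl

end AugmentedInstance

/-- The expected value of `(1 - δ) ^ (m - N)`, where `N` is the number of attempts from the `i`-th
arrival on and the `j`-th arrival is attempted independently with probability `(1 - δ) * p j`. It
bounds the probability that `m ≤ N`, that is, that the attempts use up `m` slots. -/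
noncomputable def overflowBound {n : ℕ} (p : Fin n → ℝ≥0∞) (δ : ℝ≥0∞) (i m : ℕ) : ℝ≥0∞ :=
  (1 - δ) ^ m * ∏ j : Fin n with i ≤ j.val, (1 + δ * p j)

/-- The potential of the strategy whose attempted values at the `j`-th arrival are distributed as
`(1 - δ) • ν j ≤ D j`: the expected value of the attempts from the `i`-th arrival on, discounted by
the bound on the probability that they use up the `m` slots left. -/
noncomputable def exAntePotential {n : ℕ} (ν : Fin n → Measure ℝ) (δ : ℝ≥0∞) (i m : ℕ) : ℝ≥0∞ :=
  (1 - δ) * (∑ j : Fin n with i ≤ j.val, ∫⁻ z, ENNReal.ofReal z ∂(ν j)) *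
    (1 - overflowBound (fun j => ν j Set.univ) δ i m)

theorem filter_le_val_eq_insert {n : ℕ} (i : Fin n) :
    Finset.univ.filter (fun j : Fin n => i.val ≤ j.val) =
      insert i (Finset.univ.filter fun j : Fin n => i.val + 1 ≤ j.val) := by
  ext j
  simp only [Finset.mem_filter, Finset.mem_univ, true_and, Finset.mem_insert, Fin.ext_iff]
  omega

theorem filter_le_val_eq_empty (n : ℕ) : Finset.univ.filter (fun j : Fin n => n ≤ j.val) = ∅ :=
  Finset.filter_eq_empty_iff.2 fun j _ => j.2.not_ge

section OverflowBound

variable {n : ℕ} {p : Fin n → ℝ≥0∞} {δ : ℝ≥0∞}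

theorem one_le_overflowBound_zero (i : ℕ) : 1 ≤ overflowBound p δ i 0 := by
  rw [overflowBound, pow_zero, one_mul]
  exact Finset.one_le_prod' fun j _ => le_self_add

theorem antitone_overflowBound (i : ℕ) : Antitone (overflowBound p δ i) := fun _ _ h =>
  mul_le_mul_left (pow_le_pow_right_of_le_one' tsub_le_self h) _

theorem overflowBound_succ (hδ : δ ≤ 1) {i : Fin n} {q : ℝ≥0∞} (hq : (1 - δ) * p i + q = 1)
    (m : ℕ) :
    overflowBound p δ i (m + 1) =
      (1 - δ) * p i * overflowBound p δ (i + 1) m + q * overflowBound p δ (i + 1) (m + 1) := by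
  have hfactor : 1 + δ * p i = p i + q := by
    calc 1 + δ * p i = (1 - δ) * p i + q + δ * p i := by rw [hq]
      _ = ((1 - δ) + δ) * p i + q := by ring
      _ = p i + q := by rw [tsub_add_cancel_of_le hδ, one_mul]
  simp only [overflowBound]
  rw [filter_le_val_eq_insert, Finset.prod_insert (by simp), hfactor]
  ring

end OverflowBound

theorem one_sub_mul_add_mul_le {p q : ℝ≥0∞} (h : p + q = 1) (a b : ℝ≥0∞) :
    1 - (p * a + q * b) ≤ p * (1 - a) + q * (1 - b) := by
  rw [tsub_le_iff_right]
  calc 1 = p * 1 + q * 1 := by rw [mul_one, mul_one, h]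
    _ ≤ p * (1 - a + a) + q * (1 - b + b) := by gcongr <;> exact le_tsub_add
    _ = p * (1 - a) + q * (1 - b) + (p * a + q * b) := by ring

theorem lintegral_add_le_lintegral_max {α : Type*} [MeasurableSpace α] {μ ν : Measure α}
    [IsProbabilityMeasure μ] (h : ν ≤ μ) (f : α → ℝ≥0∞) (A B : ℝ≥0∞) :
    ∫⁻ z, f z ∂ν + (ν Set.univ * A + (1 - ν Set.univ) * B) ≤ ∫⁻ z, max (f z + A) B ∂μ := by
  have : IsFiniteMeasure ν := isFiniteMeasure_of_le μ h
  calc ∫⁻ z, f z ∂ν + (ν Set.univ * A + (1 - ν Set.univ) * B)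
      = ∫⁻ _, B ∂(μ - ν) + ∫⁻ z, (f z + A) ∂ν := by
        rw [lintegral_add_right _ measurable_const, lintegral_const, lintegral_const,
          Measure.sub_apply .univ h, measure_univ (μ := μ)]
        ring
    _ ≤ ∫⁻ z, max (f z + A) B ∂(μ - ν) + ∫⁻ z, max (f z + A) B ∂ν :=
        add_le_add (lintegral_mono fun _ => le_max_right _ _)
          (lintegral_mono fun _ => le_max_left _ _)
    _ = ∫⁻ z, max (f z + A) B ∂μ := by
        rw [← lintegral_add_measure, Measure.sub_add_cancel_of_le h]

theorem isSubPotential_exAntePotential {n : ℕ} {D ν : Fin n → Measure ℝ}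
    [∀ i, IsProbabilityMeasure (D i)] (hν : ∀ i, ν i ≤ D i) {δ : ℝ≥0∞} (hδ : δ ≤ 1) :
    IsSubPotential D (exAntePotential ν δ) where
  monotone i _ _ h := mul_le_mul_right (tsub_le_tsub_left (antitone_overflowBound i h) 1) _
  last m := by simp [exAntePotential, filter_le_val_eq_empty]
  le_lintegral i m := by
    cases m with
    | zero => simp [exAntePotential, tsub_eq_zero_of_le (one_le_overflowBound_zero _)]
    | succ m =>
      have hle : (1 - δ) • ν i ≤ D i :=
        (Measure.le_iff.2 fun s _ => mul_le_of_le_one_left' tsub_le_self).trans (hν i)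
      have hmass : (1 - δ) * ν i Set.univ + (1 - (1 - δ) * ν i Set.univ) = 1 :=
        add_tsub_cancel_of_le ((hle Set.univ).trans_eq measure_univ)
      let t (k : ℕ) := overflowBound (fun j => ν j Set.univ) δ (i + 1) k
      let v := ∫⁻ z, ENNReal.ofReal z ∂(ν i)
      let V := ∑ j : Fin n with i.val + 1 ≤ j.val, ∫⁻ z, ENNReal.ofReal z ∂(ν j)
      let p := (1 - δ) * ν i Set.univ
      calc exAntePotential ν δ i (m + 1)
          = (1 - δ) * v * (1 - (p * t m + (1 - p) * t (m + 1))) +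
              (1 - δ) * V * (1 - (p * t m + (1 - p) * t (m + 1))) := by
            rw [exAntePotential, filter_le_val_eq_insert, Finset.sum_insert (by simp), mul_add,
              add_mul, overflowBound_succ hδ hmass]
        _ ≤ (1 - δ) * v + (1 - δ) * V * (p * (1 - t m) + (1 - p) * (1 - t (m + 1))) :=
            add_le_add (mul_le_of_le_one_right' tsub_le_self)
              (mul_le_mul_right (one_sub_mul_add_mul_le hmass _ _) _)
        _ = ∫⁻ z, ENNReal.ofReal z ∂((1 - δ) • ν i) + (((1 - δ) • ν i) Set.univ *
              exAntePotential ν δ (i + 1) m + (1 - ((1 - δ) • ν i) Set.univ) *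
              exAntePotential ν δ (i + 1) (m + 1)) := by
            simp only [lintegral_smul_measure, Measure.smul_apply, smul_eq_mul, exAntePotential, p,
              t, v, V]
            ring
        _ ≤ ∫⁻ z, decisionValue (exAntePotential ν δ) i (m + 1) z ∂(D i) :=
            lintegral_add_le_lintegral_max hle ENNReal.ofReal _ _

theorem one_sub_mul_exp_le {x : ℝ} (hx : 0 ≤ x) (hx1 : x < 1) :
    (1 - x) * Real.exp x ≤ Real.exp (-(x ^ 2 / 2)) := by
  have hlog : x + x ^ 2 / 2 ≤ -Real.log (1 - x) := by
    have hsum := Real.hasSum_pow_div_log_of_abs_lt_one (abs_lt.2 ⟨by linarith, hx1⟩)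
    have := sum_le_hasSum (Finset.range 2) (fun k _ => by positivity) hsum
    norm_num [Finset.sum_range_succ] at this
    linarith
  calc (1 - x) * Real.exp x = Real.exp (Real.log (1 - x) + x) := by
        rw [Real.exp_add, Real.exp_log (by linarith)]
    _ ≤ Real.exp (-(x ^ 2 / 2)) := Real.exp_le_exp.2 (by linarith)

theorem overflowBound_le_exp {n r : ℕ} {p : Fin n → ℝ≥0∞} (hp : ∑ j, p j ≤ r) {δ : ℝ}
    (hδ : 0 ≤ δ) (hδ1 : δ < 1) :
    overflowBound p (ENNReal.ofReal δ) 0 r ≤ ENNReal.ofReal (Real.exp (-(r * δ ^ 2 / 2))) := by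
  lift p to Fin n → NNReal using fun j => ne_top_of_le_ne_top (ENNReal.natCast_ne_top r)
    ((Finset.single_le_sum (fun _ _ => zero_le) (Finset.mem_univ j)).trans hp)
  have hp' : ∑ j, (p j : ℝ) ≤ r := by
    beta_reduce at hp
    exact_mod_cast hp
  have h1δ : 0 < 1 - δ := by linarith
  have hcoe : overflowBound (fun j => (p j : ℝ≥0∞)) (ENNReal.ofReal δ) 0 r =
      ENNReal.ofReal ((1 - δ) ^ r * ∏ j, (1 + δ * p j)) := by
    rw [ENNReal.ofReal_mul (by positivity), ENNReal.ofReal_pow h1δ.le,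
      ENNReal.ofReal_sub _ hδ, ENNReal.ofReal_prod_of_nonneg fun j _ => by positivity]
    simp [overflowBound, ENNReal.ofReal_add, ENNReal.ofReal_mul, hδ, mul_nonneg]
  rw [hcoe]
  refine ENNReal.ofReal_le_ofReal ?_
  calc (1 - δ) ^ r * ∏ j, (1 + δ * p j)
      ≤ (1 - δ) ^ r * Real.exp (∑ j, δ * p j) := by
        gcongr
        exact Real.prod_one_add_le_exp_sum _ fun j => by positivity
    _ ≤ (1 - δ) ^ r * Real.exp (r * δ) := by
        rw [← Finset.mul_sum, mul_comm δ]
        gcongr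
    _ = ((1 - δ) * Real.exp δ) ^ r := by rw [mul_pow, Real.exp_nat_mul]
    _ ≤ Real.exp (-(δ ^ 2 / 2)) ^ r := by
        gcongr
        exact one_sub_mul_exp_le hδ hδ1
    _ = Real.exp (-(r * δ ^ 2 / 2)) := by
        rw [← Real.exp_nat_mul]
        ring_nf

theorem OnlineAlgorithm.HasApproximationRatio.mono {n r : ℕ} {A : OnlineAlgorithm n r}
    {D : Fin n → Measure ℝ} {α β : ℝ} (h : OnlineAlgorithm.HasApproximationRatio.{u} A D α)
    (hαβ : α ≤ β) : OnlineAlgorithm.HasApproximationRatio.{u} A D β := fun Ω _ P _ Z W hZW =>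
  (ENNReal.div_le_div_left (ENNReal.ofReal_le_ofReal hαβ) _).trans (h Ω P Z W hZW)

theorem IsAugmentedInstance.measurePreserving_pi {n : ℕ} {D : Fin n → Measure ℝ} {Ω : Type*}
    [MeasurableSpace Ω] {P : Measure Ω} [IsProbabilityMeasure P] {Z W : Fin n → Ω → ℝ}
    (h : IsAugmentedInstance D P Z W) :
    MeasurePreserving (fun ω i => Z i ω) P (Measure.pi D) where
  measurable := measurable_pi_lambda _ h.measurable_Z
  map_eq := by
    simp_rw [(iIndepFun_iff_map_fun_eq_pi_map fun i => (h.measurable_Z i).aemeasurable).1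
      h.iIndepFun_Z, h.law_Z]

theorem exists_hasApproximationRatio {n r : ℕ} (D : Fin n → Measure ℝ)
    [∀ i, IsProbabilityMeasure (D i)] {δ α : ℝ} (hδ : 0 ≤ δ) (hδ1 : δ < 1) (hα : 0 < α)
    (h : α⁻¹ ≤ (1 - δ) * (1 - Real.exp (-(r * δ ^ 2 / 2)))) :
    ∃ A : OnlineAlgorithm n r, OnlineAlgorithm.HasApproximationRatio.{u} A D α := by
  obtain ⟨ν, hν, hmass, hvalue⟩ := exists_exAnte_relaxation.{u} D r
  have hpot := isSubPotential_exAntePotential hν (ENNReal.ofReal_le_one.2 hδ1.le)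
  refine ⟨greedyAlgorithm n r (exAntePotential ν (ENNReal.ofReal δ)),
    fun Ω _ P _ Z W hZW => le_trans ?_ (hpot.le_expectedReward hZW)⟩
  calc (∫⁻ ω, ENNReal.ofReal (topSum r fun i => Z i ω) ∂P) / ENNReal.ofReal α
      ≤ (∑ i, ∫⁻ z, ENNReal.ofReal z ∂(ν i)) / ENNReal.ofReal α := by
        gcongr
        exact hvalue hZW.measurePreserving_pi
    _ = ENNReal.ofReal α⁻¹ * ∑ i, ∫⁻ z, ENNReal.ofReal z ∂(ν i) := by
        rw [ENNReal.ofReal_inv_of_pos hα, ENNReal.div_eq_inv_mul]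
    _ ≤ ENNReal.ofReal ((1 - δ) * (1 - Real.exp (-(r * δ ^ 2 / 2)))) *
          ∑ i, ∫⁻ z, ENNReal.ofReal z ∂(ν i) := by gcongr
    _ = (1 - ENNReal.ofReal δ) * (∑ i, ∫⁻ z, ENNReal.ofReal z ∂(ν i)) *
          (1 - ENNReal.ofReal (Real.exp (-(r * δ ^ 2 / 2)))) := by
        rw [ENNReal.ofReal_mul (by linarith), ENNReal.ofReal_sub _ hδ,
          ENNReal.ofReal_sub _ (Real.exp_nonneg _), ENNReal.ofReal_one]
        ring
    _ ≤ exAntePotential ν (ENNReal.ofReal δ) 0 r := by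
        simp only [exAntePotential, zero_le, Finset.filter_true]
        gcongr
        exact overflowBound_le_exp hmass hδ hδ1

theorem half_le_log {x : ℝ} (hx : 2 ≤ x) : 1 / 2 ≤ Real.log x := by
  have := Real.log_le_log two_pos hx
  linarith [Real.log_two_gt_d9]

theorem log_le_half {x : ℝ} (hx : 0 < x) : Real.log x ≤ x / 2 := by
  have hsub := Real.log_le_sub_one_of_pos (half_pos hx)
  rw [Real.log_div hx.ne' two_ne_zero] at hsub
  linarith [Real.log_two_lt_d9]

theorem sqrt_log_div_self_le {x : ℝ} (hx : 0 < x) : √(Real.log x / x) ≤ 3 / 4 := by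
  rw [Real.sqrt_le_left (by norm_num), div_le_iff₀ hx]
  linarith [log_le_half hx]

theorem exp_neg_mul_sq_sqrt_log_div_self {x : ℝ} (hx : 1 ≤ x) :
    Real.exp (-(x * √(Real.log x / x) ^ 2 / 2)) = (√x)⁻¹ := by
  have hx0 : 0 < x := by linarith
  rw [Real.sq_sqrt (div_nonneg (Real.log_nonneg hx) hx0.le), mul_div_cancel₀ _ hx0.ne',
    Real.exp_neg, Real.exp_half, Real.exp_log hx0]

theorem inv_sqrt_le_two_mul_sqrt_log_div_self {x : ℝ} (hx : 2 ≤ x) :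
    (√x)⁻¹ ≤ 2 * √(Real.log x / x) := by
  have hlog : 1 / 2 ≤ √(Real.log x) := Real.le_sqrt_of_sq_le (by linarith [half_le_log hx])
  rw [Real.sqrt_div' _ (by linarith), ← mul_div_assoc, inv_eq_one_div]
  gcongr
  linarith

theorem one_le_one_add_four_mul_mul_one_sub {x : ℝ} (hx : 0 ≤ x) (hx1 : x ≤ 3 / 4) :
    1 ≤ (1 + 4 * x) * (1 - x) := by
  nlinarith

theorem inv_one_add_mul_sqrt_log_div_self_le {x : ℝ} (hx : 2 ≤ x) :
    (1 + 36 * √(Real.log x / x))⁻¹ ≤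
      (1 - √(Real.log x / x)) * (1 - Real.exp (-(x * √(Real.log x / x) ^ 2 / 2))) := by
  have hs := sqrt_log_div_self_le (show 0 < x by linarith)
  have hes := inv_sqrt_le_two_mul_sqrt_log_div_self hx
  have he : (√x)⁻¹ ≤ 3 / 4 := by
    rw [inv_le_comm₀ (by positivity) (by norm_num)]
    exact Real.le_sqrt_of_sq_le (by linarith)
  rw [exp_neg_mul_sq_sqrt_log_div_self (by linarith), inv_le_iff_one_le_mul₀' (by positivity)]
  have hs0 : 0 ≤ √(Real.log x / x) := Real.sqrt_nonneg _
  have he0 : 0 ≤ (√x)⁻¹ := by positivity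
  generalize √(Real.log x / x) = s at *
  generalize (√x)⁻¹ = e at *
  calc 1 ≤ ((1 + 4 * s) * (1 - s)) * ((1 + 4 * e) * (1 - e)) :=
        one_le_mul_of_one_le_of_one_le (one_le_one_add_four_mul_mul_one_sub hs0 hs)
          (one_le_one_add_four_mul_mul_one_sub he0 he)
    _ = ((1 + 4 * s) * (1 + 4 * e)) * ((1 - s) * (1 - e)) := by ring
    _ ≤ (1 + 36 * s) * ((1 - s) * (1 - e)) := by
        refine mul_le_mul_of_nonneg_right ?_ (mul_nonneg (by linarith) (by linarith))
        nlinarith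

theorem sqrt_log_div_self_le_two_mul {x : ℝ} (hx : 2 ≤ x) :
    √(Real.log x / x) ≤ 2 * (Real.log x ^ (3 / 2 : ℝ) / x ^ (1 / 4 : ℝ)) := by
  have hlog := half_le_log hx
  have hx4 : x ^ (1 / 4 : ℝ) ≤ √x := by
    rw [Real.sqrt_eq_rpow]
    exact Real.rpow_le_rpow_of_exponent_le (by linarith) (by norm_num)
  have hlog_rpow : Real.log x ^ (3 / 2 : ℝ) = Real.log x * √(Real.log x) := by
    rw [Real.sqrt_eq_rpow, ← Real.rpow_one_add' (by linarith) (by norm_num)]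
    norm_num
  rw [Real.sqrt_div' _ (by linarith), hlog_rpow, ← mul_div_assoc, ← mul_assoc]
  refine div_le_div₀ (by positivity) ?_ (by positivity) hx4
  exact le_mul_of_one_le_left (Real.sqrt_nonneg _) (by linarith)

theorem mainTheorem3_general :
    ∃ C : ℝ, 0 < C ∧ ∀ r : ℕ, 2 ≤ r →
      ∀ (n : ℕ) (D : Fin n → Measure ℝ), (∀ i, IsProbabilityMeasure (D i)) →
        ∃ A : OnlineAlgorithm n r,
          OnlineAlgorithm.HasApproximationRatio.{u} A D (1 + C * √(Real.log r / r)) := by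
  refine ⟨36, by norm_num, fun r hr _ D _ => ?_⟩
  have hr2 : (2 : ℝ) ≤ r := by exact_mod_cast hr
  exact exists_hasApproximationRatio D (Real.sqrt_nonneg _)
    ((sqrt_log_div_self_le (by linarith)).trans_lt (by norm_num)) (by positivity)
    (inv_one_add_mul_sqrt_log_div_self_le hr2)

theorem mainTheorem3 :
    ∃ C : ℝ, 0 < C ∧ ∀ r : ℕ, 2 ≤ r →
      ∀ (n : ℕ) (D : Fin n → Measure ℝ),
        (∀ i, IsProbabilityMeasure (D i)) → (∀ i, ∀ᵐ z ∂(D i), 0 ≤ z) →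
          ∃ A : OnlineAlgorithm n r,
            OnlineAlgorithm.HasApproximationRatio.{u} A D
              (1 + C * (Real.log r ^ (3 / 2 : ℝ) / (r : ℝ) ^ (1 / 4 : ℝ))) := by
  obtain ⟨C, hC, h⟩ := mainTheorem3_general.{u}
  refine ⟨C * 2, by positivity, fun r hr n D hD _ => (h r hr n D hD).imp fun A hA => hA.mono ?_⟩
  rw [mul_assoc]
  gcongr
  exact sqrt_log_div_self_le_two_mul (by exact_mod_cast hr)
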